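/- Let $A^*(\mathbb{T})$ denote the Beurling algebra, i.e. the set of all ($2\pi$-periodic) functions $f:\mathbb{R}\to\mathbb{C}$ of the form $$f(\xi)=\sum_{n=-\infty}^{\infty} a(n)\,e^{-in\xi}\quad(\xi\in\mathbb{R})$$ for some complex sequence $(a(n))_{n\in\mathbb{Z}}$ with $$\sum_{k=0}^{\infty}\ \sup_{|n|\ge k}|a(n)|<\infty .$$ (The latter condition makes the series absolutely convergent for every $\xi$.) If $f\in A^*(\mathbb{T})$ and $f(\xi)\neq 0$ for all $\xi\in\mathbb{R}$, then $1/f\in A^*(\mathbb{T})$. -/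

import Mathlib

open scoped ENNReal

/-- The Beurling norm `∑_{k ≥ 0} sup_{|n| ≥ k} |a(n)|` of a sequence `a : ℤ → ℂ`, with values
in `[0, ∞]`. -/
noncomputable def beurlingNorm (a : ℤ → ℂ) : ℝ≥0∞ :=
  ∑' k : ℕ, ⨆ n : {n : ℤ // (k : ℤ) ≤ |n|}, ‖a n‖ₑ

/-- The Beurling algebra `A*(𝕋)`: the (`2π`-periodic) functions `ξ ↦ ∑ₙ a(n) exp(-i n ξ)` on `ℝ`
with `∑_{k ≥ 0} sup_{|n| ≥ k} |a(n)| < ∞`. This finiteness makes the Fourier series absolutely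
convergent at every point, so that asking for the (unconditional) sum excludes nothing. -/
def BeurlingAlgebra : Set (ℝ → ℂ) :=
  {f | ∃ a : ℤ → ℂ, beurlingNorm a < ∞ ∧
    ∀ ξ : ℝ, HasSum (fun n : ℤ => a n * Complex.exp (-(Complex.I * n * ξ))) (f ξ)}

/-! The argument is Newman's proof of Wiener's lemma. Up to a constant the Beurling norm is
submultiplicative (`beurlingNorm_convolution_le`), and trigonometric polynomials are dense for it
(`HasBeurlingBound.exists_trigPoly`). If `|1/f| ≤ r`, pick a trigonometric polynomial `P` so close
to `f` that `|1/P| ≤ 2r`, and expand `1/f = ∑ (P - f)^j / P^(j+1)`.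

The factor `(P - f)^j` has norm at most `(8ε)^j`. Two integrations by parts bound the norm of a
smooth function by its sup norm and that of its second derivative, so `P^(-(j+1))` has norm
`O((j+1)^2 (2r)^(j+1))` (`HasBeurlingBound.inv_pow_trigPoly`): differentiation costs only a
polynomial factor in `j`. For small `ε` the series therefore converges in norm. -/

/-! ### Tail suprema and convolution -/

/-- The supremum `sup_{|n| ≥ k} |a(n)|` of the tail of a sequence. -/
noncomputable def tailSup (a : ℤ → ℂ) (k : ℕ) : ℝ≥0∞ :=
  ⨆ n : {n : ℤ // (k : ℤ) ≤ |n|}, ‖a n‖ₑ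

theorem beurlingNorm_eq_tsum_tailSup (a : ℤ → ℂ) : beurlingNorm a = ∑' k, tailSup a k := rfl

theorem enorm_le_tailSup (a : ℤ → ℂ) {k : ℕ} {n : ℤ} (h : (k : ℤ) ≤ |n|) :
    ‖a n‖ₑ ≤ tailSup a k :=
  le_iSup (fun n : {n : ℤ // (k : ℤ) ≤ |n|} => ‖a n‖ₑ) ⟨n, h⟩

theorem tailSup_le {a : ℤ → ℂ} {k : ℕ} {C : ℝ≥0∞} (h : ∀ n : ℤ, (k : ℤ) ≤ |n| → ‖a n‖ₑ ≤ C) :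
    tailSup a k ≤ C :=
  iSup_le fun n => h n n.2

theorem tailSup_anti (a : ℤ → ℂ) {k l : ℕ} (h : k ≤ l) : tailSup a l ≤ tailSup a k :=
  tailSup_le fun _ hn => enorm_le_tailSup a (le_trans (by exact_mod_cast h) hn)

/-- The indices `k` and `-(k + 1)` are both charged to the `k`-th tail supremum, whence the 2. -/
theorem tsum_enorm_le_beurlingNorm (a : ℤ → ℂ) : ∑' n, ‖a n‖ₑ ≤ 2 * beurlingNorm a := by
  have h := (HasSum.of_nat_of_neg_add_one (f := fun n : ℤ => ‖a n‖ₑ)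
    ENNReal.summable.hasSum ENNReal.summable.hasSum).tsum_eq
  rw [h, two_mul, beurlingNorm_eq_tsum_tailSup]
  refine add_le_add (ENNReal.tsum_le_tsum fun k => enorm_le_tailSup a (by simp))
    (ENNReal.tsum_le_tsum fun k => enorm_le_tailSup a ?_)
  rw [abs_neg, abs_of_nonneg (by positivity)]
  omega

theorem summable_norm_of_tsum_enorm_ne_top {ι : Type*} {a : ι → ℂ} (h : ∑' n, ‖a n‖ₑ ≠ ∞) :
    Summable fun n => ‖a n‖ := by
  simpa using ENNReal.summable_toReal h

theorem summable_norm_of_beurlingNorm_ne_top {a : ℤ → ℂ} (h : beurlingNorm a ≠ ∞) :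
    Summable fun n => ‖a n‖ :=
  summable_norm_of_tsum_enorm_ne_top
    (ne_top_of_le_ne_top (ENNReal.mul_ne_top (by simp) h) (tsum_enorm_le_beurlingNorm a))

theorem beurlingNorm_tsum_le (a : ℕ → ℤ → ℂ) :
    beurlingNorm (fun n => ∑' j, a j n) ≤ ∑' j, beurlingNorm (a j) := by
  simp only [beurlingNorm_eq_tsum_tailSup]
  rw [ENNReal.tsum_comm]
  exact ENNReal.tsum_le_tsum fun k => tailSup_le fun n hn =>
    enorm_tsum_le_tsum_enorm.trans (ENNReal.tsum_le_tsum fun j => enorm_le_tailSup (a j) hn)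

theorem tsum_tailSup_half (a : ℤ → ℂ) : ∑' k : ℕ, tailSup a (k / 2) = 2 * beurlingNorm a := by
  rw [← tsum_even_add_odd ENNReal.summable ENNReal.summable, two_mul,
    beurlingNorm_eq_tsum_tailSup]
  congr 1
  · exact tsum_congr fun k => by congr 1; omega
  · exact tsum_congr fun k => by congr 1; omega

/-- When `|n| ≥ k`, either `|m|` or `|n - m|` is at least `k / 2`; the other factor is summed
freely. -/
theorem tailSup_convolution_le (a b : ℤ → ℂ) (k : ℕ) :
    tailSup (fun n => ∑' m, a m * b (n - m)) k ≤
      tailSup a (k / 2) * ∑' n, ‖b n‖ₑ + (∑' n, ‖a n‖ₑ) * tailSup b (k / 2) := by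
  refine tailSup_le fun n hn => enorm_tsum_le_tsum_enorm.trans ?_
  have hb : ∑' m, ‖b (n - m)‖ₑ = ∑' m, ‖b m‖ₑ :=
    (Equiv.subLeft n).tsum_eq (fun m => ‖b m‖ₑ)
  rw [← hb, ← ENNReal.tsum_mul_left, ← ENNReal.tsum_mul_right, ← ENNReal.tsum_add]
  refine ENNReal.tsum_le_tsum fun m => ?_
  rw [enorm_mul]
  by_cases hm : ((k / 2 : ℕ) : ℤ) ≤ |m|
  · exact le_add_right (mul_le_mul_left (enorm_le_tailSup a hm) _)
  · have h1 : |n| ≤ |m| + |n - m| := by simpa using abs_add_le m (n - m)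
    exact le_add_left (mul_le_mul_right (enorm_le_tailSup b (by omega)) _)

theorem beurlingNorm_convolution_le (a b : ℤ → ℂ) :
    beurlingNorm (fun n => ∑' m, a m * b (n - m)) ≤ 8 * beurlingNorm a * beurlingNorm b := by
  calc
    beurlingNorm (fun n => ∑' m, a m * b (n - m))
      ≤ ∑' k : ℕ, (tailSup a (k / 2) * ∑' n, ‖b n‖ₑ + (∑' n, ‖a n‖ₑ) * tailSup b (k / 2)) :=
        ENNReal.tsum_le_tsum fun k => tailSup_convolution_le a b k
    _ = 2 * beurlingNorm a * ∑' n, ‖b n‖ₑ + (∑' n, ‖a n‖ₑ) * (2 * beurlingNorm b) := by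
        rw [ENNReal.tsum_add, ENNReal.tsum_mul_right, ENNReal.tsum_mul_left,
          tsum_tailSup_half, tsum_tailSup_half]
    _ ≤ 2 * beurlingNorm a * (2 * beurlingNorm b) + 2 * beurlingNorm a * (2 * beurlingNorm b) := by
        gcongr <;> exact tsum_enorm_le_beurlingNorm _
    _ = 8 * beurlingNorm a * beurlingNorm b := by ring

/-! ### The algebra of functions with a Beurling bound -/

/-- The character `ξ ↦ exp(-i n ξ)`. -/
noncomputable def expChar (n : ℤ) (ξ : ℝ) : ℂ := Complex.exp (-(Complex.I * n * ξ))

theorem norm_expChar (n : ℤ) (ξ : ℝ) : ‖expChar n ξ‖ = 1 := by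
  simp [expChar, Complex.norm_exp]

theorem expChar_add (m n : ℤ) (ξ : ℝ) : expChar (m + n) ξ = expChar m ξ * expChar n ξ := by
  rw [expChar, expChar, expChar, ← Complex.exp_add]
  congr 1
  push_cast
  ring

/-- `f` is the sum of a Fourier series whose coefficients have Beurling norm at most `C`. -/
def HasBeurlingBound (f : ℝ → ℂ) (C : ℝ≥0∞) : Prop :=
  ∃ a : ℤ → ℂ, beurlingNorm a ≤ C ∧ ∀ ξ : ℝ, HasSum (fun n => a n * expChar n ξ) (f ξ)

/-- The change of variables `(n, m) ↦ (m, n - m)`. -/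
def subPairEquiv : ℤ × ℤ ≃ ℤ × ℤ where
  toFun x := (x.2, x.1 - x.2)
  invFun x := (x.1 + x.2, x.1)
  left_inv x := by simp
  right_inv x := by simp

namespace HasBeurlingBound

theorem mul {f g : ℝ → ℂ} {C D : ℝ≥0∞} (hf : HasBeurlingBound f C) (hg : HasBeurlingBound g D)
    (hC : C ≠ ∞) (hD : D ≠ ∞) : HasBeurlingBound (fun ξ => f ξ * g ξ) (8 * C * D) := by
  obtain ⟨a, ha, hfa⟩ := hf
  obtain ⟨b, hb, hgb⟩ := hg
  have hN : beurlingNorm (fun n => ∑' m, a m * b (n - m)) ≤ 8 * C * D :=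
    (beurlingNorm_convolution_le a b).trans (mul_le_mul' (mul_le_mul' le_rfl ha) hb)
  refine ⟨fun n => ∑' m, a m * b (n - m), hN, fun ξ => ?_⟩
  have hsa := summable_norm_of_beurlingNorm_ne_top (ne_top_of_le_ne_top hC ha)
  have hsb := summable_norm_of_beurlingNorm_ne_top (ne_top_of_le_ne_top hD hb)
  have hsa' : Summable fun n => ‖a n * expChar n ξ‖ := by simpa [norm_expChar] using hsa
  have hsb' : Summable fun n => ‖b n * expChar n ξ‖ := by simpa [norm_expChar] using hsb
  have hprod : HasSum (fun x : ℤ × ℤ => (a x.1 * expChar x.1 ξ) * (b x.2 * expChar x.2 ξ))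
      (f ξ * g ξ) := by
    rw [← (hfa ξ).tsum_eq, ← (hgb ξ).tsum_eq, tsum_mul_tsum_of_summable_norm hsa' hsb']
    exact (summable_mul_of_summable_norm hsa' hsb').hasSum
  have h : HasSum (fun x : ℤ × ℤ => a x.2 * b (x.1 - x.2) * expChar x.1 ξ) (f ξ * g ξ) := by
    refine (subPairEquiv.hasSum_iff.2 hprod).congr_fun fun x => ?_
    have hm := expChar_add x.2 (x.1 - x.2) ξ
    rw [add_sub_cancel] at hm
    rw [hm]
    simp only [subPairEquiv, Function.comp, Equiv.coe_fn_mk]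
    ring
  refine (h.prod_fiberwise fun n => (h.summable.prod_factor n).hasSum).congr_fun fun n => ?_
  exact tsum_mul_right.symm

theorem one : HasBeurlingBound (fun _ => 1) 1 := by
  refine ⟨Pi.single 0 1, ?_, fun ξ => ?_⟩
  · rw [beurlingNorm_eq_tsum_tailSup, tsum_eq_single 0]
    · refine tailSup_le fun n _ => ?_
      by_cases hn : n = 0 <;> simp [hn]
    · intro k hk
      refine le_antisymm (tailSup_le fun n hn => ?_) zero_le
      have : n ≠ 0 := by
        rintro rfl
        simp at hn
        omega
      simp [this]
  · have h := hasSum_single (f := fun n : ℤ => (Pi.single 0 1 : ℤ → ℂ) n * expChar n ξ) 0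
      (fun n hn => by simp [hn])
    simpa [expChar] using h

theorem pow {f : ℝ → ℂ} {C : ℝ≥0∞} (hf : HasBeurlingBound f C) (hC : C ≠ ∞) (j : ℕ) :
    HasBeurlingBound (fun ξ => f ξ ^ j) ((8 * C) ^ j) := by
  induction j with
  | zero => simpa using one
  | succ j ih =>
    have h := ih.mul hf (by finiteness) hC
    simp only [pow_succ]
    convert h using 1
    ring

theorem tsum {f : ℕ → ℝ → ℂ} {C : ℕ → ℝ≥0∞} (hf : ∀ j, HasBeurlingBound (f j) (C j))
    (hC : ∑' j, C j ≠ ∞) : HasBeurlingBound (fun ξ => ∑' j, f j ξ) (∑' j, C j) := by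
  choose a ha hfa using hf
  refine ⟨fun n => ∑' j, a j n, (beurlingNorm_tsum_le a).trans (ENNReal.tsum_le_tsum ha),
    fun ξ => ?_⟩
  have hs : Summable fun x : ℤ × ℕ => a x.2 x.1 * expChar x.1 ξ := by
    refine Summable.of_norm (summable_norm_of_tsum_enorm_ne_top ?_)
    have hle : ∑' x : ℤ × ℕ, ‖a x.2 x.1 * expChar x.1 ξ‖ₑ ≤ 2 * ∑' j, C j := by
      rw [ENNReal.tsum_prod (f := fun n j => ‖a j n * expChar n ξ‖ₑ), ENNReal.tsum_comm,
        ← ENNReal.tsum_mul_left]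
      refine ENNReal.tsum_le_tsum fun j => ?_
      have : ∀ n, ‖expChar n ξ‖ₑ = 1 := fun n => by
        rw [← ofReal_norm, norm_expChar, ENNReal.ofReal_one]
      simp only [enorm_mul, this, mul_one]
      exact (tsum_enorm_le_beurlingNorm _).trans (by gcongr; exact ha j)
    exact ne_top_of_le_ne_top (by finiteness) hle
  have hcomm : HasSum (fun x : ℕ × ℤ => a x.1 x.2 * expChar x.2 ξ) (∑' j, f j ξ) := by
    have h := ((Equiv.prodComm ℕ ℤ).summable_iff.2 hs).hasSum
    have h' := (h.prod_fiberwise fun j => hfa j ξ).tsum_eq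
    rw [h']
    exact h
  have h := (Equiv.prodComm ℤ ℕ).hasSum_iff.2 hcomm
  have h' := h.prod_fiberwise fun n => (h.summable.prod_factor n).hasSum
  convert h' using 2 with n
  rw [← tsum_mul_right]
  rfl

theorem norm_le {f : ℝ → ℂ} {C : ℝ} (hC : 0 ≤ C) (hf : HasBeurlingBound f (ENNReal.ofReal C))
    (ξ : ℝ) : ‖f ξ‖ ≤ 2 * C := by
  obtain ⟨a, ha, hfa⟩ := hf
  have : ∀ n, ‖expChar n ξ‖ₑ = 1 := fun n => by
    rw [← ofReal_norm, norm_expChar, ENNReal.ofReal_one]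
  have h : ‖f ξ‖ₑ ≤ ENNReal.ofReal (2 * C) := by
    rw [← (hfa ξ).tsum_eq]
    refine enorm_tsum_le_tsum_enorm.trans ?_
    simp only [enorm_mul, this, mul_one]
    refine (tsum_enorm_le_beurlingNorm a).trans ?_
    rw [ENNReal.ofReal_mul (by norm_num)]
    simpa using mul_le_mul_right ha 2
  rw [← ofReal_norm] at h
  exact (ENNReal.ofReal_le_ofReal_iff (by positivity)).1 h

theorem continuous {f : ℝ → ℂ} {C : ℝ≥0∞} (hf : HasBeurlingBound f C) (hC : C ≠ ∞) :
    Continuous f := by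
  obtain ⟨a, ha, hfa⟩ := hf
  have hs := summable_norm_of_beurlingNorm_ne_top (ne_top_of_le_ne_top hC ha)
  rw [show f = fun ξ => ∑' n, a n * expChar n ξ from funext fun ξ => (hfa ξ).tsum_eq.symm]
  refine continuous_tsum (fun n => ?_) hs fun n ξ => by simp [norm_expChar]
  unfold expChar
  fun_prop

end HasBeurlingBound

/-! ### Periodicity and approximation by trigonometric polynomials -/

theorem expChar_periodic (n : ℤ) : Function.Periodic (expChar n) (2 * Real.pi) := by
  intro ξ
  unfold expChar
  rw [Complex.exp_eq_exp_iff_exists_int]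
  exact ⟨-n, by push_cast; ring⟩

theorem HasBeurlingBound.periodic {f : ℝ → ℂ} {C : ℝ≥0∞} (hf : HasBeurlingBound f C) :
    Function.Periodic f (2 * Real.pi) := by
  obtain ⟨a, -, hfa⟩ := hf
  intro ξ
  rw [← (hfa ξ).tsum_eq, ← (hfa (ξ + 2 * Real.pi)).tsum_eq]
  simp only [expChar_periodic _ ξ]

/-- The trigonometric polynomial with coefficients `a` on the finite set `s`. -/
noncomputable def trigPoly (s : Finset ℤ) (a : ℤ → ℂ) (ξ : ℝ) : ℂ := ∑ n ∈ s, a n * expChar n ξ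

theorem tailSup_truncate_le (a : ℤ → ℂ) (N k : ℕ) :
    tailSup (fun n => if n ∈ Finset.Ioo (-(N : ℤ)) N then 0 else a n) k ≤ tailSup a (max N k) := by
  refine tailSup_le fun n hn => ?_
  split_ifs with h
  · simp
  · refine enorm_le_tailSup a ?_
    rw [Finset.mem_Ioo, ← abs_lt] at h
    push_cast
    exact max_le (not_lt.1 h) hn

/-- Dominated convergence in `N`: `tailSup a k` dominates, and each term tends to 0 because the tail
suprema are summable. -/
theorem exists_tsum_tailSup_max_lt {a : ℤ → ℂ} (ha : beurlingNorm a ≠ ∞) {ε : ℝ≥0∞} (hε : 0 < ε) :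
    ∃ N : ℕ, ∑' k, tailSup a (max N k) < ε := by
  have htop : ∀ k, tailSup a k ≠ ∞ := fun k =>
    ne_top_of_le_ne_top ha (ENNReal.le_tsum (f := tailSup a) k)
  have h : Filter.Tendsto (fun N => ∑' k, (tailSup a (max N k)).toReal) Filter.atTop
      (nhds (∑' _ : ℕ, 0)) := by
    refine tendsto_tsum_of_dominated_convergence (bound := fun k => (tailSup a k).toReal)
      (ENNReal.summable_toReal ha) (fun k => ?_) (Filter.Eventually.of_forall fun N k => ?_)
    · have h0 := (ENNReal.summable_toReal ha).tendsto_atTop_zero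
      refine h0.comp (Filter.tendsto_atTop_mono (fun N => le_max_left N k) Filter.tendsto_id)
    · rw [Real.norm_of_nonneg ENNReal.toReal_nonneg]
      exact ENNReal.toReal_mono (htop _) (tailSup_anti a (le_max_right N k))
  rw [tsum_zero] at h
  have h' := ENNReal.tendsto_ofReal h
  rw [ENNReal.ofReal_zero] at h'
  obtain ⟨N, hN⟩ := (h'.eventually (gt_mem_nhds hε)).exists
  refine ⟨N, lt_of_eq_of_lt ?_ hN⟩
  rw [← ENNReal.tsum_toReal_eq fun k => htop _, ENNReal.ofReal_toReal]
  exact ne_top_of_le_ne_top ha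
    (ENNReal.tsum_le_tsum fun k => tailSup_anti a (le_max_right N k))

theorem HasBeurlingBound.exists_trigPoly {f : ℝ → ℂ} {C : ℝ≥0∞} (hf : HasBeurlingBound f C)
    (hC : C ≠ ∞) {ε : ℝ≥0∞} (hε : 0 < ε) :
    ∃ s a, HasBeurlingBound (fun ξ => trigPoly s a ξ - f ξ) ε := by
  obtain ⟨a, ha, hfa⟩ := hf
  obtain ⟨N, hN⟩ := exists_tsum_tailSup_max_lt (ne_top_of_le_ne_top hC ha) hε
  set s := Finset.Ioo (-(N : ℤ)) N with hs
  refine ⟨s, a, fun n => -(if n ∈ s then 0 else a n), ?_, fun ξ => ?_⟩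
  · have : beurlingNorm (fun n => -(if n ∈ s then 0 else a n)) =
        beurlingNorm (fun n => if n ∈ s then 0 else a n) := by simp [beurlingNorm]
    rw [this]
    exact (ENNReal.tsum_le_tsum fun k => tailSup_truncate_le a N k).trans hN.le
  · have h1 : HasSum (fun n => if n ∈ s then a n * expChar n ξ else 0) (trigPoly s a ξ) := by
      have := hasSum_sum_of_ne_finset_zero (s := s) (L := .unconditional ℤ)
        (f := fun n => if n ∈ s then a n * expChar n ξ else 0) (fun n hn => by simp [hn])
      rwa [Finset.sum_congr rfl fun n hn => if_pos hn] at this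
    refine (h1.sub (hfa ξ)).congr_fun fun n => ?_
    by_cases hn : n ∈ s <;> simp [hn]

/-! ### Fourier coefficients of smooth periodic functions -/

theorem norm_fourierCoeffOn_le {a b : ℝ} (hab : a < b) {g : ℝ → ℂ} {M : ℝ}
    (hM : ∀ x, ‖g x‖ ≤ M) (n : ℤ) : ‖fourierCoeffOn hab g n‖ ≤ M := by
  have hba : 0 < b - a := sub_pos.2 hab
  have h : ‖∫ x in a..b, fourier (-n) (x : AddCircle (b - a)) • g x‖ ≤ M * |b - a| :=
    intervalIntegral.norm_integral_le_of_norm_le_const fun x _ => by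
      rw [norm_smul, fourier_apply, Circle.norm_coe, one_mul]
      exact hM x
  rw [fourierCoeffOn_eq_integral, norm_smul, Real.norm_of_nonneg (by positivity)]
  rw [abs_of_pos hba] at h
  calc 1 / (b - a) * _ ≤ 1 / (b - a) * (M * (b - a)) := by gcongr
    _ = M := by field_simp

theorem fourierCoeffOn_eq_of_hasDerivAt_periodic {T : ℝ} (hT : 0 < T) {g g' : ℝ → ℂ}
    (hg : ∀ x, HasDerivAt g (g' x) x) (hg' : Continuous g') (hper : Function.Periodic g T)
    {n : ℤ} (hn : n ≠ 0) :
    fourierCoeffOn hT g n = T / (2 * Real.pi * Complex.I * n) * fourierCoeffOn hT g' n := by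
  rw [fourierCoeffOn_of_hasDerivAt hT hn (fun x _ => hg x) (hg'.intervalIntegrable _ _),
    hper.eq, sub_self, mul_zero, zero_sub]
  push_cast
  simp only [sub_zero]
  ring

/-- Two integrations by parts give `M / n^2` for `n ≠ 0`. The form `4 / (|n| + 1)^2` also covers `n
= 0`, and follows from `|n| + 1 ≤ 2|n|` otherwise. -/
theorem norm_fourierCoeffOn_two_pi_le {g g' g'' : ℝ → ℂ} {M : ℝ}
    (hg : ∀ x, HasDerivAt g (g' x) x) (hg' : ∀ x, HasDerivAt g' (g'' x) x)
    (hg'' : Continuous g'') (hper : Function.Periodic g (2 * Real.pi))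
    (hM : ∀ x, ‖g x‖ ≤ M) (hM'' : ∀ x, ‖g'' x‖ ≤ M) (n : ℤ) :
    ‖fourierCoeffOn Real.two_pi_pos g n‖ ≤ 4 / (|(n : ℝ)| + 1) ^ 2 * M := by
  have hM0 : 0 ≤ M := (norm_nonneg _).trans (hM 0)
  rcases eq_or_ne n 0 with rfl | hn
  · refine (norm_fourierCoeffOn_le _ hM 0).trans ?_
    norm_num
    linarith
  have hper' : Function.Periodic g' (2 * Real.pi) := fun x => by
    have h := (hg (x + 2 * Real.pi)).comp_add_const x (2 * Real.pi)
    rw [show (fun x => g (x + 2 * Real.pi)) = g from funext hper] at h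
    exact h.unique (hg x)
  rw [fourierCoeffOn_eq_of_hasDerivAt_periodic _ hg
      (continuous_iff_continuousAt.2 fun x => (hg' x).continuousAt) hper hn,
    fourierCoeffOn_eq_of_hasDerivAt_periodic _ hg' hg'' hper' hn, norm_mul, norm_mul]
  have hc : ‖((2 * Real.pi : ℝ) : ℂ) / (2 * Real.pi * Complex.I * n)‖ = 1 / |(n : ℝ)| := by
    simp [abs_of_pos Real.pi_pos]
    field_simp
  rw [hc, ← mul_assoc]
  have hn1 : (1 : ℝ) ≤ |(n : ℝ)| := by exact_mod_cast Int.one_le_abs hn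
  refine mul_le_mul ?_ (norm_fourierCoeffOn_le _ hM'' n) (norm_nonneg _) (by positivity)
  rw [div_mul_div_comm, one_mul, div_le_div_iff₀ (by positivity) (by positivity)]
  nlinarith

/-- The Beurling norm of the sequence `4 / (|n| + 1)²`. -/
noncomputable def smoothConst : ℝ≥0∞ := ∑' k : ℕ, ENNReal.ofReal (4 / ((k : ℝ) + 1) ^ 2)

theorem smoothConst_ne_top : smoothConst ≠ ∞ := by
  refine Summable.tsum_ofReal_ne_top ?_
  have h := (summable_nat_add_iff 1).2 (Real.summable_one_div_nat_pow.2 one_lt_two)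
  convert! h.mul_left 4 using 2 with k
  push_cast
  ring

theorem HasBeurlingBound.of_hasDerivAt {g g' g'' : ℝ → ℂ} {M : ℝ}
    (hg : ∀ x, HasDerivAt g (g' x) x) (hg' : ∀ x, HasDerivAt g' (g'' x) x)
    (hg'' : Continuous g'') (hper : Function.Periodic g (2 * Real.pi))
    (hM : ∀ x, ‖g x‖ ≤ M) (hM'' : ∀ x, ‖g'' x‖ ≤ M) :
    HasBeurlingBound g (smoothConst * ENNReal.ofReal M) := by
  have hM0 : 0 ≤ M := (norm_nonneg _).trans (hM 0)
  have : Fact (0 < 2 * Real.pi) := ⟨Real.two_pi_pos⟩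
  have hcont : Continuous g := continuous_iff_continuousAt.2 fun x => (hg x).continuousAt
  have hlift : Continuous (hper.lift : AddCircle (2 * Real.pi) → ℂ) :=
    hcont.quotient_lift _
  let G : C(AddCircle (2 * Real.pi), ℂ) := ⟨hper.lift, hlift⟩
  set c : ℤ → ℂ := fun n => fourierCoeff G n with hcdef
  have hc : ∀ n, ‖c n‖ ≤ 4 / (|(n : ℝ)| + 1) ^ 2 * M := fun n => by
    have h1 := norm_fourierCoeffOn_two_pi_le hg hg' hg'' hper hM hM'' n
    have h2 : c n = fourierCoeffOn Real.two_pi_pos g n := by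
      rw [fourierCoeffOn_eq_integral, hcdef]
      simp only [fourierCoeff_eq_intervalIntegral _ n 0, sub_zero, zero_add]
      refine congrArg _ (intervalIntegral.integral_congr fun x _ => ?_)
      simp only [fourier_coe_apply, sub_zero]
      rfl
    rwa [h2]
  -- The index is negated because `expChar n` is `exp(-inξ)`, opposite to the sign in `fourier n`.
  have hN : beurlingNorm (fun n => c (-n)) ≤ smoothConst * ENNReal.ofReal M := by
    rw [smoothConst, ← ENNReal.tsum_mul_right, beurlingNorm_eq_tsum_tailSup]
    refine ENNReal.tsum_le_tsum fun k => tailSup_le fun n hn => ?_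
    rw [← ENNReal.ofReal_mul (by positivity), ← ofReal_norm]
    refine ENNReal.ofReal_le_ofReal ((hc (-n)).trans ?_)
    have hk : (k : ℝ) ≤ |(n : ℝ)| := by exact_mod_cast hn
    push_cast
    rw [abs_neg]
    gcongr
  refine ⟨fun n => c (-n), hN, fun ξ => ?_⟩
  have hs : Summable (fourierCoeff G) := by
    have h := summable_norm_of_beurlingNorm_ne_top
      (ne_top_of_le_ne_top (ENNReal.mul_ne_top smoothConst_ne_top ENNReal.ofReal_ne_top) hN)
    exact ((Equiv.neg ℤ).summable_iff (f := fun n => ‖c n‖)).1 h |>.of_norm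
  have h := has_pointwise_sum_fourier_series_of_summable hs (ξ : AddCircle (2 * Real.pi))
  refine ((Equiv.neg ℤ).hasSum_iff.2 h).congr_fun fun n => ?_
  simp only [Function.comp, Equiv.neg_apply, fourier_coe_apply, smul_eq_mul, expChar, hcdef]
  congr 2
  push_cast
  have := Real.pi_ne_zero
  field_simp

/-! ### Powers of reciprocals of trigonometric polynomials -/

theorem hasDerivAt_trigPoly (s : Finset ℤ) (a : ℤ → ℂ) (ξ : ℝ) :
    HasDerivAt (trigPoly s a) (trigPoly s (fun n => -(Complex.I * n) * a n) ξ) ξ := by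
  unfold trigPoly expChar
  refine HasDerivAt.fun_sum fun n _ => ?_
  have h : HasDerivAt (fun ξ : ℝ => -(Complex.I * n * (ξ : ℂ))) (-(Complex.I * n * 1)) ξ :=
    ((Complex.ofRealCLM.hasDerivAt (x := ξ)).const_mul (Complex.I * (n : ℂ))).neg
  convert! h.cexp.const_mul (a n) using 1
  ring

theorem trigPoly_periodic (s : Finset ℤ) (a : ℤ → ℂ) :
    Function.Periodic (trigPoly s a) (2 * Real.pi) := fun ξ => by
  simp only [trigPoly, expChar_periodic _ ξ]

theorem continuous_trigPoly (s : Finset ℤ) (a : ℤ → ℂ) : Continuous (trigPoly s a) :=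
  continuous_iff_continuousAt.2 fun ξ => (hasDerivAt_trigPoly s a ξ).continuousAt

/-- The second derivative of `Q^(j+1)` brings down at most two factors of size `j + 1`. As `q ≥ 1`,
the remaining lower powers of `Q` are still bounded by `q^(j+1)`. -/
theorem HasBeurlingBound.pow_of_hasDerivAt {Q Q' Q'' : ℝ → ℂ} {q B : ℝ}
    (hQ : ∀ x, HasDerivAt Q (Q' x) x) (hQ' : ∀ x, HasDerivAt Q' (Q'' x) x)
    (hQ'' : Continuous Q'') (hper : Function.Periodic Q (2 * Real.pi))
    (hq : 1 ≤ q) (hB : 1 ≤ B) (hQq : ∀ x, ‖Q x‖ ≤ q) (hQB : ∀ x, ‖Q' x‖ ≤ B)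
    (hQB' : ∀ x, ‖Q'' x‖ ≤ B) (j : ℕ) :
    HasBeurlingBound (fun x => Q x ^ (j + 1))
      (smoothConst * ENNReal.ofReal (2 * B ^ 2 * ((j + 1) ^ 2 * q ^ (j + 1)))) := by
  have hc : Continuous Q := continuous_iff_continuousAt.2 fun x => (hQ x).continuousAt
  have hc' : Continuous Q' := continuous_iff_continuousAt.2 fun x => (hQ' x).continuousAt
  have hB2 : B ≤ B ^ 2 := by nlinarith
  have hj : (1 : ℝ) ≤ (j + 1) ^ 2 := one_le_pow₀ (by linarith [Nat.cast_nonneg (α := ℝ) j])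
  have hq0 : 0 < q ^ (j + 1) := by positivity
  refine HasBeurlingBound.of_hasDerivAt (g' := fun x => (j + 1) * (Q x ^ j * Q' x))
    (g'' := fun x => (j + 1) * ((j * Q x ^ (j - 1) * Q' x) * Q' x + Q x ^ j * Q'' x))
    (fun x => ?_) (fun x => ?_) (by fun_prop) (fun x => by simp only [hper x])
    (fun x => ?_) fun x => ?_
  · convert! (hQ x).fun_pow (j + 1) using 1
    push_cast
    ring
  · exact (((hQ x).fun_pow j).fun_mul (hQ' x)).const_mul _
  · rw [norm_pow]
    have h1 : ‖Q x‖ ^ (j + 1) ≤ q ^ (j + 1) := by gcongr; exact hQq x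
    have h2 : 1 ≤ 2 * B ^ 2 := by nlinarith
    have h3 : 1 ≤ 2 * B ^ 2 * (j + 1) ^ 2 := one_le_mul_of_one_le_of_one_le h2 hj
    nlinarith
  -- At `j = 0` the truncated exponent `j - 1` is harmless: its term carries the factor `j`.
  · have h1 : ‖Q x‖ ^ (j - 1) ≤ q ^ (j + 1) :=
      (pow_le_pow_left₀ (norm_nonneg _) (hQq x) _).trans (pow_le_pow_right₀ hq (by omega))
    have h2 : ‖Q x‖ ^ j ≤ q ^ (j + 1) :=
      (pow_le_pow_left₀ (norm_nonneg _) (hQq x) _).trans (pow_le_pow_right₀ hq (by omega))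
    have hjn : ‖(j : ℂ) + 1‖ = j + 1 := by exact_mod_cast Complex.norm_natCast (j + 1)
    calc
      ‖((j : ℂ) + 1) * ((j * Q x ^ (j - 1) * Q' x) * Q' x + Q x ^ j * Q'' x)‖
        ≤ (j + 1) * ((j * ‖Q x‖ ^ (j - 1) * ‖Q' x‖) * ‖Q' x‖ + ‖Q x‖ ^ j * ‖Q'' x‖) := by
          rw [norm_mul, hjn]
          gcongr
          refine (norm_add_le _ _).trans (le_of_eq ?_)
          simp
      _ ≤ (j + 1) * ((j * q ^ (j + 1) * B) * B + q ^ (j + 1) * B) := by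
          gcongr <;> first | exact hQB x | exact hQB' x
      _ ≤ (j + 1) * (((j + 1) * q ^ (j + 1) * B) * B + (j + 1) * q ^ (j + 1) * B ^ 2) := by
          have : q ^ (j + 1) ≤ (j + 1) * q ^ (j + 1) := by
            nlinarith [mul_nonneg (Nat.cast_nonneg (α := ℝ) j) hq0.le]
          gcongr
          linarith
      _ = 2 * B ^ 2 * ((j + 1) ^ 2 * q ^ (j + 1)) := by ring

theorem exists_one_le_norm_bound {g : ℝ → ℂ} (hg : Continuous g)
    (hper : Function.Periodic g (2 * Real.pi)) : ∃ B : ℝ, 1 ≤ B ∧ ∀ x, ‖g x‖ ≤ B := by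
  obtain ⟨B, hB⟩ := (isCompact_Icc (a := (0 : ℝ)) (b := 2 * Real.pi)).exists_bound_of_continuousOn
    hg.continuousOn
  refine ⟨max 1 B, le_max_left _ _, fun x => ?_⟩
  obtain ⟨y, hy, hxy⟩ := hper.exists_mem_Ico₀ Real.two_pi_pos x
  rw [hxy]
  exact (hB y (Set.Ico_subset_Icc_self hy)).trans (le_max_right _ _)

theorem HasBeurlingBound.inv_pow_trigPoly (s : Finset ℤ) (a : ℤ → ℂ) {q : ℝ} (hq : 1 ≤ q)
    (h0 : ∀ x, trigPoly s a x ≠ 0) (hP : ∀ x, ‖(trigPoly s a x)⁻¹‖ ≤ q) :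
    ∃ B : ℝ, 0 ≤ B ∧ ∀ j : ℕ, HasBeurlingBound (fun x => (trigPoly s a x)⁻¹ ^ (j + 1))
      (smoothConst * ENNReal.ofReal (B * ((j + 1) ^ 2 * q ^ (j + 1)))) := by
  set P := trigPoly s a with hPdef
  set b : ℤ → ℂ := fun n => -(Complex.I * n) * a n
  set c : ℤ → ℂ := fun n => -(Complex.I * n) * b n
  have hd : ∀ x, HasDerivAt P (trigPoly s b x) x := hasDerivAt_trigPoly s a
  have hd' : ∀ x, HasDerivAt (trigPoly s b) (trigPoly s c x) x := hasDerivAt_trigPoly s b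
  have hPc : Continuous P := continuous_trigPoly s a
  have hbc := continuous_trigPoly s b
  have hcc := continuous_trigPoly s c
  have hpa : Function.Periodic P (2 * Real.pi) := trigPoly_periodic s a
  have hpb := trigPoly_periodic s b
  have hpc := trigPoly_periodic s c
  set Q : ℝ → ℂ := fun x => (P x)⁻¹ with hQdef
  have hQc : Continuous Q := hPc.inv₀ h0
  have hpQ : Function.Periodic Q (2 * Real.pi) := fun x => by simp only [hQdef, hpa x]
  have hQ : ∀ x, HasDerivAt Q (-trigPoly s b x * Q x ^ 2) x := fun x => by
    convert! (hd x).fun_inv (h0 x) using 1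
    simp only [hQdef, inv_pow, div_eq_mul_inv]
  have hQ' : ∀ x, HasDerivAt (fun x => -trigPoly s b x * Q x ^ 2)
      (-trigPoly s c x * Q x ^ 2 + -trigPoly s b x * (2 * Q x * (-trigPoly s b x * Q x ^ 2))) x :=
    fun x => by
      convert! (hd' x).fun_neg.fun_mul ((hQ x).fun_pow 2) using 1
      simp
  obtain ⟨B₁, hB₁, hB₁'⟩ := exists_one_le_norm_bound
    (g := fun x => -trigPoly s b x * Q x ^ 2) (by fun_prop)
    (fun x => by simp only [hpb x, hpQ x])
  obtain ⟨B₂, hB₂, hB₂'⟩ := exists_one_le_norm_bound (g := fun x => -trigPoly s c x * Q x ^ 2 +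
    -trigPoly s b x * (2 * Q x * (-trigPoly s b x * Q x ^ 2))) (by fun_prop)
    (fun x => by simp only [hpb x, hpc x, hpQ x])
  exact ⟨2 * max B₁ B₂ ^ 2, by positivity, fun j =>
    HasBeurlingBound.pow_of_hasDerivAt hQ hQ' (by fun_prop) hpQ hq (hB₁.trans (le_max_left _ _)) hP
      (fun x => (hB₁' x).trans (le_max_left _ _)) (fun x => (hB₂' x).trans (le_max_right _ _)) j⟩

/-! ### Inversion by a geometric series -/

theorem exists_norm_inv_le {f : ℝ → ℂ} (hf : Continuous f)
    (hper : Function.Periodic f (2 * Real.pi)) (h0 : ∀ x, f x ≠ 0) :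
    ∃ r : ℝ, 1 ≤ r ∧ ∀ x, ‖(f x)⁻¹‖ ≤ r :=
  exists_one_le_norm_bound (hf.inv₀ h0) fun x => by simp only [hper x]

theorem norm_inv_le_of_norm_sub_le {z w : ℂ} {r : ℝ} (hr : 0 < r) (hz : z ≠ 0)
    (hzr : ‖z⁻¹‖ ≤ r) (h : ‖w - z‖ ≤ 1 / (2 * r)) : w ≠ 0 ∧ ‖w⁻¹‖ ≤ 2 * r := by
  have h1 : 1 / r ≤ ‖z‖ := by
    rw [norm_inv] at hzr
    rw [one_div]
    exact inv_le_of_inv_le₀ (norm_pos_iff.2 hz) hzr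
  have h2 : ‖z‖ ≤ ‖w‖ + ‖w - z‖ := by
    simpa using norm_sub_le w (w - z)
  have h3 : 1 / (2 * r) = 1 / r / 2 := by field_simp
  have h4 : 1 / (2 * r) ≤ ‖w‖ := by linarith
  have h5 : 0 < ‖w‖ := lt_of_lt_of_le (by positivity) h4
  refine ⟨norm_pos_iff.1 h5, ?_⟩
  rw [norm_inv]
  rw [one_div] at h4
  exact inv_le_of_inv_le₀ (by positivity) h4

theorem HasBeurlingBound.exists_inv {f : ℝ → ℂ} {C : ℝ≥0∞} (hf : HasBeurlingBound f C)
    (hC : C ≠ ∞) (h0 : ∀ x, f x ≠ 0) :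
    ∃ D, D ≠ ∞ ∧ HasBeurlingBound (fun x => (f x)⁻¹) D := by
  obtain ⟨r, hr1, hr⟩ := exists_norm_inv_le (hf.continuous hC) hf.periodic h0
  have hr0 : 0 < r := by linarith
  -- This gives `2ε ≤ 1 / (2r)`, which keeps `P` away from 0, and `8ε · 2r = 1/2`, the ratio of the
  -- series of norms.
  set ε : ℝ := 1 / (32 * r) with hε
  have hε0 : 0 < ε := by positivity
  obtain ⟨s, a, hPf⟩ := hf.exists_trigPoly hC (ENNReal.ofReal_pos.2 hε0)
  set P := trigPoly s a with hPdef
  have hεr : ε * r = 1 / 32 := by rw [hε]; field_simp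
  have hclose : ∀ x, ‖P x - f x‖ ≤ 2 * ε := fun x => hPf.norm_le hε0.le x
  have hPinv : ∀ x, P x ≠ 0 ∧ ‖(P x)⁻¹‖ ≤ 2 * r := fun x =>
    norm_inv_le_of_norm_sub_le hr0 (h0 x) (hr x) ((hclose x).trans (by
      rw [le_div_iff₀ (by positivity)]
      nlinarith))
  obtain ⟨B, hB0, hB⟩ := HasBeurlingBound.inv_pow_trigPoly s a (q := 2 * r) (by linarith)
    (fun x => (hPinv x).1) fun x => (hPinv x).2
  have hterm : ∀ j : ℕ, HasBeurlingBound (fun x => (P x - f x) ^ j * (P x)⁻¹ ^ (j + 1))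
      (8 * smoothConst * ENNReal.ofReal (B * (2 * r) * ((j + 1) ^ 2 * (1 / 2) ^ j))) := fun j => by
    have h := (hPf.pow ENNReal.ofReal_ne_top j).mul (hB j) (by finiteness)
      (ENNReal.mul_ne_top smoothConst_ne_top ENNReal.ofReal_ne_top)
    convert h using 1
    rw [show (8 : ℝ≥0∞) * ENNReal.ofReal ε = ENNReal.ofReal (8 * ε) by
        rw [ENNReal.ofReal_mul (by norm_num)]; norm_num,
      ← ENNReal.ofReal_pow (by positivity)]
    have : B * (2 * r) * (((j : ℝ) + 1) ^ 2 * (1 / 2) ^ j) =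
        (8 * ε) ^ j * (B * ((j + 1) ^ 2 * (2 * r) ^ (j + 1))) := by
      rw [show (1 / 2 : ℝ) = 8 * ε * (2 * r) by linarith, mul_pow]
      ring
    rw [this, ENNReal.ofReal_mul (by positivity)]
    ring
  have hsum : ∑' j : ℕ, 8 * smoothConst *
      ENNReal.ofReal (B * (2 * r) * (((j : ℝ) + 1) ^ 2 * (1 / 2) ^ j)) ≠ ∞ := by
    rw [ENNReal.tsum_mul_left]
    refine ENNReal.mul_ne_top (ENNReal.mul_ne_top (by simp) smoothConst_ne_top)
      (Summable.tsum_ofReal_ne_top (Summable.mul_left _ ?_))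
    have h := (summable_nat_add_iff 1).2
      (summable_pow_mul_geometric_of_norm_lt_one 2 (r := (1 / 2 : ℝ)) (by norm_num))
    convert h.mul_left 2 using 2 with j
    push_cast
    ring
  refine ⟨_, hsum, ?_⟩
  convert HasBeurlingBound.tsum hterm hsum using 2 with x
  have hP0 := (hPinv x).1
  have hlt : ‖(P x - f x) * (P x)⁻¹‖ < 1 := by
    rw [norm_mul]
    calc ‖P x - f x‖ * ‖(P x)⁻¹‖ ≤ 2 * ε * (2 * r) := by
          gcongr
          exacts [hclose x, (hPinv x).2]
      _ < 1 := by linarith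
  -- The sum is `P⁻¹ (1 - (P - f) / P)⁻¹ = 1/f`.
  have hgeo := tsum_geometric_of_norm_lt_one hlt
  have : ∀ j : ℕ, (P x - f x) ^ j * (P x)⁻¹ ^ (j + 1) =
      (P x)⁻¹ * ((P x - f x) * (P x)⁻¹) ^ j := fun j => by rw [mul_pow]; ring
  simp only [this]
  rw [tsum_mul_left, hgeo, ← mul_inv]
  congr 1
  field_simp
  ring

theorem mainTheorem7 (f : ℝ → ℂ) (hf : f ∈ BeurlingAlgebra) (hf0 : ∀ ξ : ℝ, f ξ ≠ 0) :
    (fun ξ : ℝ => 1 / f ξ) ∈ BeurlingAlgebra := by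
  obtain ⟨a, ha, hfa⟩ := hf
  have hbound : HasBeurlingBound f (beurlingNorm a) := ⟨a, le_rfl, hfa⟩
  obtain ⟨D, hD, b, hb, hfb⟩ := hbound.exists_inv ha.ne hf0
  refine ⟨b, hb.trans_lt hD.lt_top, fun ξ => ?_⟩
  simpa only [one_div] using! hfb ξ
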